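/- Let $\mathbb X,\mathbb A,\mathbb W$ be complete separable metric spaces with their Borel $\sigma$-fields, $\mathbb A\neq\varnothing$, let $f:\mathbb X\times\mathbb A\times\mathbb W\to\mathbb X$ and $r:\mathbb X\times\mathbb A\to[0,r_\vee]$ be uniformly continuous, and let $\alpha\in(0,1)$. Let $\mathcal Q\subset\mathcal P(\mathbb A)$ and $\mathcal P\subset\mathcal P(\mathbb W)$ be Borel sets of probability measures (for the weak topology), with $\mathcal P\ne\varnothing$ and $\delta_a\in\mathcal Q$ for every $a\in\mathbb A$. A controller policy $\pi=(\pi_t)_{t\ge0}$ is a sequence of measurable maps $h_t=(x_0,a_0,\dots,a_{t-1},x_t)\mapsto\pi_t(da|h_t)\in\mathcal P(\mathbb A)$. An adversary policy $\gamma=(\gamma_t)_{t\ge0}$ is a sequence of measurable maps $g_t=(h_t,a_t)\mapsto\gamma_t(dw|g_t)\in\mathcal P(\mathbb W)$; it is current-action-unaware (CAU) if $\gamma_t(dw|h_t,a)$ does not depend on $a$. A policy of either player is Markov if its decision at each time $t$ depends on the past only through $x_t$ (and $a_t$ for the adversary), and stationary if moreover this dependence is the same for all $t$. Let $\Pi_{\rm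 H}(\mathcal Q)\supset\Pi_{\rm M}(\mathcal Q)\supset\Pi_{\rm S}(\mathcal Q)$ be the sets of all, of all Markov and of all stationary controller policies with decisions in $\mathcal Q$, and $\overline\Gamma_{\rm H}(\mathcal P)\supset\overline\Gamma_{\rm M}(\mathcal P)\supset\overline\Gamma_{\rm S}(\mathcal P)$ the sets of all, of all Markov and of all stationary CAU adversary policies with decisions in $\mathcal P$. For $x\in\mathbb X$ let $E_x^{\pi,\gamma}$ be the expectation under the law of $(X_0,A_0,W_0,A_1,W_1,\dots)$ with $X_0=x$, $A_t\sim\pi_t(\cdot|H_t)$ given $H_t=(X_0,A_0,\dots,A_{t-1},X_t)$, $W_t\sim\gamma_t(\cdot|H_t,A_t)$ given the past and $A_t$, and $X_{t+1}=f(X_t,A_t,W_t)$. For classes $\Pi,\Gamma$ of controller and adversary policies put $$v^*(x,\Pi,\Gamma)=\sup_{\pi\in\Pi}\inf_{\gamma\in\Gamma}E_x^{\pi,\gamma}\sum_{t=0}^\infty\alpha^t r(X_t,A_t).$$ **Theorem.** There is exactly one bounded continuous function $\bar u^*:\mathbb X\to\mathbb R$ that solves the CAU Bellman equation $$\bar u(x)=\sup_{\phi\in\mathcal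 Q}\inf_{\psi\in\mathcal P}\int_{\mathbb A\times\mathbb W}\bigl(r(x,a)+\alpha\,\bar u(f(x,a,w))\bigr)\,(\phi\times\psi)(da,dw),\qquad x\in\mathbb X.$$ Moreover, for every $x\in\mathbb X$, $$\begin{aligned}\bar u^*(x)&=v^*(x,\Pi_{\rm H}(\mathcal Q),\overline\Gamma_{\rm H}(\mathcal P))=v^*(x,\Pi_{\rm M}(\mathcal Q),\overline\Gamma_{\rm H}(\mathcal P))=v^*(x,\Pi_{\rm M}(\mathcal Q),\overline\Gamma_{\rm M}(\mathcal P))\\&=v^*(x,\Pi_{\rm S}(\mathcal Q),\overline\Gamma_{\rm H}(\mathcal P))=v^*(x,\Pi_{\rm S}(\mathcal Q),\overline\Gamma_{\rm M}(\mathcal P))=v^*(x,\Pi_{\rm S}(\mathcal Q),\overline\Gamma_{\rm S}(\mathcal P)).\end{aligned}$$ In particular, restricting the controller to stationary (possibly randomized) policies does not lower the value against history-dependent or against Markov CAU adversaries. -/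

import Mathlib

open MeasureTheory ProbabilityTheory
open scoped BoundedContinuousFunction

noncomputable section

namespace DRSC

/-- Controller's histories `h_t = (x_0, a_0, …, x_{t-1}, a_{t-1}, x_t)`, written as
`(g_{t-1}, x_t)` with `g_{t-1} = ((x_0, a_0), …, (x_{t-1}, a_{t-1}))`. The adversary's histories
`g_t = (h_t, a_t)` are the elements of `Hist X A t × A`. -/
abbrev Hist (X A : Type*) (t : ℕ) : Type _ := (Fin t → X × A) × X

section Policies

variable (X A W : Type*) [MeasurableSpace X] [MeasurableSpace A] [MeasurableSpace W]

/-- A history-dependent (randomized) policy of the controller: a sequence of measurable decisions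
`π_t(da | h_t)`. The σ-field on `ProbabilityMeasure A` is the one generated by the evaluations
`μ ↦ μ B`; for a Polish space `A` it is the Borel σ-field of the topology of weak convergence. -/
structure ControlPolicy where
  decision : (t : ℕ) → Hist X A t → ProbabilityMeasure A
  measurable_decision : ∀ t, Measurable (decision t)

/-- A history-dependent policy of the adversary: a sequence of measurable decisions
`γ_t(dw | g_t)`, `g_t = (h_t, a_t)`. -/
structure AdversaryPolicy where
  decision : (t : ℕ) → Hist X A t × A → ProbabilityMeasure W
  measurable_decision : ∀ t, Measurable (decision t)

end Policies

section Classes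

variable {X A W : Type*} [MeasurableSpace X] [MeasurableSpace A] [MeasurableSpace W]

/-- Given `x_t`, the decision does not depend on `g_{t-1}`. -/
def ControlPolicy.IsMarkov (π : ControlPolicy X A) : Prop :=
  ∀ (t : ℕ) (g g' : Fin t → X × A) (x : X), π.decision t (g, x) = π.decision t (g', x)

/-- The decision depends neither on `g_{t-1}` nor on the time `t`. -/
def ControlPolicy.IsStationary (π : ControlPolicy X A) : Prop :=
  ∀ (s t : ℕ) (g : Fin t → X × A) (g' : Fin s → X × A) (x : X),
    π.decision t (g, x) = π.decision s (g', x)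

def AdversaryPolicy.IsMarkov (γ : AdversaryPolicy X A W) : Prop :=
  ∀ (t : ℕ) (g g' : Fin t → X × A) (x : X) (a : A),
    γ.decision t ((g, x), a) = γ.decision t ((g', x), a)

def AdversaryPolicy.IsStationary (γ : AdversaryPolicy X A W) : Prop :=
  ∀ (s t : ℕ) (g : Fin t → X × A) (g' : Fin s → X × A) (x : X) (a : A),
    γ.decision t ((g, x), a) = γ.decision s ((g', x), a)

/-- Current-action-unaware: `γ_t(dw | h_t, a)` does not depend on `a`. -/
def AdversaryPolicy.IsCAU (γ : AdversaryPolicy X A W) : Prop :=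
  ∀ (t : ℕ) (h : Hist X A t) (a a' : A), γ.decision t (h, a) = γ.decision t (h, a')

/-- The class `Π_H(𝒬)`. -/
def PiH (X : Type*) [MeasurableSpace X] (Q : Set (ProbabilityMeasure A)) :
    Set (ControlPolicy X A) :=
  {π | ∀ t h, π.decision t h ∈ Q}

/-- The class `Π_M(𝒬)`. -/
def PiM (X : Type*) [MeasurableSpace X] (Q : Set (ProbabilityMeasure A)) :
    Set (ControlPolicy X A) :=
  {π | π ∈ PiH X Q ∧ π.IsMarkov}

/-- The class `Π_S(𝒬)`. -/
def PiS (X : Type*) [MeasurableSpace X] (Q : Set (ProbabilityMeasure A)) :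
    Set (ControlPolicy X A) :=
  {π | π ∈ PiH X Q ∧ π.IsStationary}

/-- The class of history-dependent CAU adversaries with decisions in `𝒫`. -/
def GammaBarH (X A : Type*) [MeasurableSpace X] [MeasurableSpace A]
    (P : Set (ProbabilityMeasure W)) : Set (AdversaryPolicy X A W) :=
  {γ | (∀ t g, γ.decision t g ∈ P) ∧ γ.IsCAU}

/-- The class of Markov CAU adversaries with decisions in `𝒫`. -/
def GammaBarM (X A : Type*) [MeasurableSpace X] [MeasurableSpace A]
    (P : Set (ProbabilityMeasure W)) : Set (AdversaryPolicy X A W) :=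
  {γ | γ ∈ GammaBarH X A P ∧ γ.IsMarkov}

/-- The class of time-homogeneous CAU adversaries with decisions in `𝒫`. -/
def GammaBarS (X A : Type*) [MeasurableSpace X] [MeasurableSpace A]
    (P : Set (ProbabilityMeasure W)) : Set (AdversaryPolicy X A W) :=
  {γ | γ ∈ GammaBarH X A P ∧ γ.IsStationary}

end Classes

section Law

variable {X A W : Type*} [MeasurableSpace X] [MeasurableSpace A] [MeasurableSpace W]

/-- `π_t` as a Markov kernel. -/
def ControlPolicy.kernel (π : ControlPolicy X A) (t : ℕ) : Kernel (Hist X A t) A where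
  toFun h := (π.decision t h : Measure A)
  measurable' := measurable_subtype_coe.comp (π.measurable_decision t)

instance (π : ControlPolicy X A) (t : ℕ) : IsMarkovKernel (π.kernel t) :=
  ⟨fun h => (π.decision t h).prop⟩

/-- `γ_t` as a Markov kernel. -/
def AdversaryPolicy.kernel (γ : AdversaryPolicy X A W) (t : ℕ) : Kernel (Hist X A t × A) W where
  toFun g := (γ.decision t g : Measure W)
  measurable' := measurable_subtype_coe.comp (γ.measurable_decision t)

instance (γ : AdversaryPolicy X A W) (t : ℕ) : IsMarkovKernel (γ.kernel t) :=
  ⟨fun g => (γ.decision t g).prop⟩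

/-- The conditional law `π_t(da | h_t) γ_t(dw | h_t, a)` of `(A_t, W_t)` given `h_t`. -/
def decisionKernel (π : ControlPolicy X A) (γ : AdversaryPolicy X A W) (t : ℕ) :
    Kernel (Hist X A t) (A × W) :=
  π.kernel t ⊗ₖ γ.kernel t

instance (π : ControlPolicy X A) (γ : AdversaryPolicy X A W) (t : ℕ) :
    IsMarkovKernel (decisionKernel π γ t) := by
  unfold decisionKernel; infer_instance

/-- The next state `x_{t+1} = f(x_t, a_t, w_t)` after `(x_k, a_k, w_k)`, `k ≤ t`. -/
def nextState (f : X → A → W → X) (t : ℕ) (p : Finset.Iic t → X × A × W) : X :=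
  f (p ⟨t, by simp⟩).1 (p ⟨t, by simp⟩).2.1 (p ⟨t, by simp⟩).2.2

/-- The history `h_{t+1} = (x_0, a_0, …, x_t, a_t, x_{t+1})` after `(x_k, a_k, w_k)`, `k ≤ t`. -/
def nextHist (f : X → A → W → X) (t : ℕ) (p : Finset.Iic t → X × A × W) : Hist X A (t + 1) :=
  (fun i => ((p ⟨i, by simpa using Nat.le_of_lt_succ i.isLt⟩).1,
    (p ⟨i, by simpa using Nat.le_of_lt_succ i.isLt⟩).2.1), nextState f t p)

theorem measurable_nextState {f : X → A → W → X}
    (hf : Measurable fun p : X × A × W => f p.1 p.2.1 p.2.2) (t : ℕ) :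
    Measurable (nextState f t) :=
  hf.comp (measurable_pi_apply _)

theorem measurable_nextHist {f : X → A → W → X}
    (hf : Measurable fun p : X × A × W => f p.1 p.2.1 p.2.2) (t : ℕ) :
    Measurable (nextHist f t) := by
  refine Measurable.prodMk ?_ (measurable_nextState hf t)
  refine measurable_pi_lambda _ fun i => ?_
  fun_prop

/-- The conditional law of `(X_{t+1}, A_{t+1}, W_{t+1})` given `(X_k, A_k, W_k)`, `k ≤ t`:
`X_{t+1}` is `f(X_t, A_t, W_t)`, and `(A_{t+1}, W_{t+1})` is drawn from the players' decisions at
the history `h_{t+1}`. -/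
def stepKernel (f : X → A → W → X) (hf : Measurable fun p : X × A × W => f p.1 p.2.1 p.2.2)
    (π : ControlPolicy X A) (γ : AdversaryPolicy X A W) (t : ℕ) :
    Kernel (Finset.Iic t → X × A × W) (X × A × W) :=
  Kernel.deterministic (nextState f t) (measurable_nextState hf t) ×ₖ
    (decisionKernel π γ (t + 1)).comap (nextHist f t) (measurable_nextHist hf t)

instance (f : X → A → W → X) (hf : Measurable fun p : X × A × W => f p.1 p.2.1 p.2.2)
    (π : ControlPolicy X A) (γ : AdversaryPolicy X A W) (t : ℕ) :
    IsMarkovKernel (stepKernel f hf π γ t) := by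
  unfold stepKernel; infer_instance

/-- The law of `(X_0, A_0, W_0)` when `X_0` has law `μ`. -/
def initialLaw (μ : Measure X) (π : ControlPolicy X A) (γ : AdversaryPolicy X A W) :
    Measure (X × A × W) :=
  μ ⊗ₘ (decisionKernel π γ 0).comap (fun x : X => ((Fin.elim0, x) : Hist X A 0))
    (measurable_const.prodMk measurable_id)

instance (μ : Measure X) [IsProbabilityMeasure μ] (π : ControlPolicy X A)
    (γ : AdversaryPolicy X A W) : IsProbabilityMeasure (initialLaw μ π γ) := by
  unfold initialLaw; infer_instance

/-- The canonical space of the `ω = (x_0, (a_0, w_0), (a_1, w_1), …)`. -/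
abbrev Path (X A W : Type*) : Type _ := X × (ℕ → A × W)

/-- The action process `A_t`. -/
def action (t : ℕ) (ω : Path X A W) : A := (ω.2 t).1

/-- The noise process `W_t`. -/
def noise (t : ℕ) (ω : Path X A W) : W := (ω.2 t).2

/-- The state process: `X_0 = x_0` and `X_{t+1} = f(X_t, A_t, W_t)`. -/
def state (f : X → A → W → X) : ℕ → Path X A W → X
  | 0, ω => ω.1
  | t + 1, ω => f (state f t ω) (action t ω) (noise t ω)

/-- The law `P_μ^{π,γ}` on the canonical space: `x_0 ∼ μ`, and, successively, `a_t ∼ π_t(· | h_t)`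
and `w_t ∼ γ_t(· | h_t, a_t)`. It is the image under `(x_t, a_t, w_t)_t ↦ (x_0, (a_t, w_t)_t)` of
the law of the triples given by the Ionescu-Tulcea theorem. -/
def pathLaw (f : X → A → W → X) (hf : Measurable fun p : X × A × W => f p.1 p.2.1 p.2.2)
    (μ : Measure X) [IsProbabilityMeasure μ]
    (π : ControlPolicy X A) (γ : AdversaryPolicy X A W) : Measure (Path X A W) :=
  (Kernel.trajMeasure (X := fun _ => X × A × W) (initialLaw μ π γ) (stepKernel f hf π γ)).map
    (fun p => ((p 0).1, fun t => (p t).2))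

/-- The expected discounted reward `E_μ^{π,γ} ∑_{t ≥ 0} α^t r(X_t, A_t)`. -/
def policyValue (f : X → A → W → X) (hf : Measurable fun p : X × A × W => f p.1 p.2.1 p.2.2)
    (r : X → A → ℝ) (α : ℝ) (μ : Measure X) [IsProbabilityMeasure μ]
    (π : ControlPolicy X A) (γ : AdversaryPolicy X A W) : ℝ :=
  ∫ ω, ∑' t : ℕ, α ^ t * r (state f t ω) (action t ω) ∂(pathLaw f hf μ π γ)

/-- The max-min value `v^*(x, Π, Γ)` of the policy classes `Π`, `Γ` at the initial state `x`. -/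
def drscValue (f : X → A → W → X) (hf : Measurable fun p : X × A × W => f p.1 p.2.1 p.2.2)
    (r : X → A → ℝ) (α : ℝ) (x : X)
    (Pi : Set (ControlPolicy X A)) (Gam : Set (AdversaryPolicy X A W)) : ℝ :=
  ⨆ π : Pi, ⨅ γ : Gam, policyValue f hf r α (Measure.dirac x) π.1 γ.1

/-- The Bellman operator of the CAU adversary. -/
def cauBellman (f : X → A → W → X) (r : X → A → ℝ) (α : ℝ) (Q : Set (ProbabilityMeasure A))
    (P : Set (ProbabilityMeasure W)) (u : X → ℝ) (x : X) : ℝ :=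
  ⨆ φ : Q, ⨅ ψ : P, ∫ z : A × W, (r x z.1 + α * u (f x z.1 z.2))
    ∂((φ.1 : Measure A).prod (ψ.1 : Measure W))

end Law

end DRSC

end

/-! Sup-inf is nonexpansive for the uniform norm, so the Bellman operator contracts with factor α.
It preserves uniform continuity because the modulus of the one-stage payoff in the state does not
depend on the decisions. Banach's theorem on the closed subspace of uniformly continuous functions
gives a fixed point `u`; the contraction estimate makes it unique among all bounded continuous
functions.

All six values equal `u` because of two guarantees. A stationary controller secures u - ε against
every CAU adversary (`exists_mem_PiS_forall_le_policyValue`): a decision nearly optimal at one state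
stays so on a ball of fixed radius, so countably many decisions suffice. Conversely, the adversary
moves second in the sup-inf. Against a known policy it knows the distribution φ = π_t(·|h_t), though
not the action drawn, and a measurable reply S(x_t, φ) keeps the one-stage payoff below u + ε
(`exists_measurable_adversary_reply`). This reply is CAU, and is Markov or stationary whenever the
controller is, so it belongs to each adversary class considered. Neither a minimax exchange nor
compactness enters.

Current-action-unawareness makes the conditional law of (A_t, W_t) the product φ × ψ of the Bellman
equation (`decisionKernel_apply_of_isCAU`). One-step inequalities become inequalities of values by
telescoping α^t E u(X_t) (`policyValue_le`, `le_policyValue`). -/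

namespace DRSC

open Filter Topology

set_option linter.unusedSectionVars false

/-! ### Sup-inf values -/

section SupInf

variable {ι κ : Type*} {F G : ι → κ → ℝ} {C d : ℝ}

theorem bddBelow_range_of_abs_le {F : κ → ℝ} (hF : ∀ k, |F k| ≤ C) :
    BddBelow (Set.range F) :=
  ⟨-C, by rintro _ ⟨k, rfl⟩; exact (abs_le.1 (hF k)).1⟩

theorem bddAbove_range_of_abs_le {F : κ → ℝ} (hF : ∀ k, |F k| ≤ C) :
    BddAbove (Set.range F) :=
  ⟨C, by rintro _ ⟨k, rfl⟩; exact (abs_le.1 (hF k)).2⟩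

theorem abs_iInf_le [Nonempty κ] {F : κ → ℝ} (hF : ∀ k, |F k| ≤ C) : |⨅ k, F k| ≤ C :=
  abs_le.2 ⟨le_ciInf fun k => (abs_le.1 (hF k)).1,
    (ciInf_le (bddBelow_range_of_abs_le hF) (Classical.arbitrary κ)).trans (abs_le.1 (hF _)).2⟩

theorem abs_iSup_le [Nonempty κ] {F : κ → ℝ} (hF : ∀ k, |F k| ≤ C) : |⨆ k, F k| ≤ C :=
  abs_le.2 ⟨(abs_le.1 (hF _)).1.trans
    (le_ciSup (bddAbove_range_of_abs_le hF) (Classical.arbitrary κ)),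
    ciSup_le fun k => (abs_le.1 (hF k)).2⟩

/-- Sup-inf is monotone and commutes with adding constants. The common bound `C` and nonemptiness
keep the real `⨆` and `⨅` away from their default values. -/
theorem iSup_iInf_le_add [Nonempty ι] [Nonempty κ] (hF : ∀ i k, |F i k| ≤ C)
    (hG : ∀ i k, |G i k| ≤ C) (h : ∀ i k, F i k ≤ G i k + d) :
    ⨆ i, ⨅ k, F i k ≤ (⨆ i, ⨅ k, G i k) + d := by
  refine ciSup_le fun i => ?_
  have h1 : ⨅ k, F i k ≤ (⨅ k, G i k) + d := by
    rw [← sub_le_iff_le_add]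
    refine le_ciInf fun k => ?_
    have := ciInf_le (bddBelow_range_of_abs_le (hF i)) k
    linarith [h i k]
  have h2 := le_ciSup (bddAbove_range_of_abs_le fun i => abs_iInf_le (hG i)) i
  linarith

theorem abs_iSup_iInf_sub_le [Nonempty ι] [Nonempty κ] (hF : ∀ i k, |F i k| ≤ C)
    (hG : ∀ i k, |G i k| ≤ C) (h : ∀ i k, |F i k - G i k| ≤ d) :
    |(⨆ i, ⨅ k, F i k) - ⨆ i, ⨅ k, G i k| ≤ d := by
  have h1 := iSup_iInf_le_add hF hG fun i k => by linarith [(abs_le.1 (h i k)).2]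
  have h2 := iSup_iInf_le_add hG hF (d := d) fun i k => by linarith [(abs_le.1 (h i k)).1]
  exact abs_le.2 ⟨by linarith, by linarith⟩

end SupInf

/-! ### Countable selections -/

/-- A countable measurable cover with a point attached to each member has a measurable choice. -/
theorem exists_measurable_choice {α β : Type*} [MeasurableSpace α] [MeasurableSpace β]
    {E : ℕ → Set α} (hE : ∀ n, MeasurableSet (E n)) (hcov : ∀ x, ∃ n, x ∈ E n) (y : ℕ → β) :
    ∃ s : α → β, Measurable s ∧ ∀ x, ∃ n, x ∈ E n ∧ s x = y n := by
  classical
  refine ⟨fun x => y (Nat.find (hcov x)), ?_, fun x => ⟨_, Nat.find_spec (hcov x), rfl⟩⟩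
  exact (measurable_from_nat (f := y)).comp (measurable_find hcov hE)

/-- The space of probability measures on a separable metric space is hereditarily separable. -/
theorem exists_seq_dense_probabilityMeasure {W : Type*} [MetricSpace W]
    [SecondCountableTopology W] [MeasurableSpace W] [BorelSpace W]
    {P : Set (ProbabilityMeasure W)} (hP : P.Nonempty) :
    ∃ D : ℕ → ProbabilityMeasure W, (∀ n, D n ∈ P) ∧
      ∀ ψ ∈ P, ∃ k : ℕ → ℕ, Tendsto (fun n => D (k n)) atTop (𝓝 ψ) := by
  classical
  let B := TopologicalSpace.countableBasis W
  have hB : TopologicalSpace.IsTopologicalBasis B := TopologicalSpace.isBasis_countableBasis W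
  -- Finite intersections of basic open sets form a countable π-system of open sets, and convergence
  -- of measures on it implies weak convergence.
  let S : Set (Set W) := Set.sInter '' {F : Set (Set W) | F.Finite ∧ F ⊆ B}
  have hSc : S.Countable :=
    (Set.countable_ofPred_finite_subset (TopologicalSpace.countable_countableBasis W)).image _
  have hSo : ∀ s ∈ S, IsOpen s := by
    rintro _ ⟨F, ⟨hF, hFB⟩, rfl⟩
    exact hF.isOpen_sInter fun t ht => hB.isOpen (hFB ht)
  have hSpi : IsPiSystem S := by
    rintro _ ⟨F, ⟨hF, hFB⟩, rfl⟩ _ ⟨F', ⟨hF', hFB'⟩, rfl⟩ -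
    exact ⟨F ∪ F', ⟨hF.union hF', Set.union_subset hFB hFB'⟩, Set.sInter_union F F'⟩
  have := hSc.to_subtype
  -- The target is a countable product of copies of `NNReal`, so every subset of it is separable and
  -- its closures are sequential; no topological property of `P` is needed.
  let Φ : ProbabilityMeasure W → S → NNReal := fun ψ s => ψ s
  obtain ⟨c, hcP, hc, hdense⟩ :=
    (TopologicalSpace.IsSeparable.of_separableSpace (Φ '' P)).exists_countable_dense_subset
  have hcne : c.Nonempty := by
    obtain ⟨ψ, hψ⟩ := hP
    by_contra h
    rw [Set.not_nonempty_iff_eq_empty.1 h, closure_empty] at hdense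
    exact hdense ⟨ψ, hψ, rfl⟩
  obtain ⟨e, rfl⟩ := hc.exists_eq_range hcne
  choose D hDP hDe using fun n => hcP ⟨n, rfl⟩
  refine ⟨D, hDP, fun ψ hψ => ?_⟩
  obtain ⟨v, hv, hlim⟩ := mem_closure_iff_seq_limit.1 (hdense ⟨ψ, hψ, rfl⟩)
  choose k hk using hv
  refine ⟨k, hSpi.tendsto_probabilityMeasure_of_tendsto_of_mem
    (fun s hs => (hSo s hs).measurableSet) ?_ ?_⟩
  · intro U hU x hx
    obtain ⟨t, htB, hxt, htU⟩ := hB.exists_subset_of_mem_open hx hU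
    exact ⟨t, ⟨{t}, ⟨Set.finite_singleton t, by simpa using htB⟩, by simp⟩,
      (hB.isOpen htB).mem_nhds hxt, htU⟩
  · intro s hs
    have h1 := (tendsto_pi_nhds.1 hlim) ⟨s, hs⟩
    refine h1.congr fun n => ?_
    rw [← hk n, ← hDe]

/-! ### The one-stage payoff -/

section Stage

variable {X A W : Type*} [MeasurableSpace X] [MeasurableSpace A] [MeasurableSpace W]

/-- The expected one-stage payoff `∫ (r(x,a) + α u(f(x,a,w))) (φ × ψ)(da, dw)`. -/
noncomputable def stage (f : X → A → W → X) (r : X → A → ℝ) (α : ℝ) (u : X → ℝ) (x : X)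
    (φ : ProbabilityMeasure A) (ψ : ProbabilityMeasure W) : ℝ :=
  ∫ z : A × W, (r x z.1 + α * u (f x z.1 z.2)) ∂((φ : Measure A).prod (ψ : Measure W))

theorem cauBellman_eq (f : X → A → W → X) (r : X → A → ℝ) (α : ℝ)
    (Q : Set (ProbabilityMeasure A)) (P : Set (ProbabilityMeasure W)) (u : X → ℝ) (x : X) :
    cauBellman f r α Q P u x = ⨆ φ : Q, ⨅ ψ : P, stage f r α u x φ.1 ψ.1 := rfl

end Stage

theorem abs_integral_le_of_abs_le {Ω : Type*} [MeasurableSpace Ω] {μ : Measure Ω}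
    [IsProbabilityMeasure μ] {g : Ω → ℝ} {C : ℝ} (hg : ∀ z, |g z| ≤ C) : |∫ z, g z ∂μ| ≤ C := by
  simpa using norm_integral_le_of_norm_le_const (μ := μ) (f := g) (C := C)
    (Eventually.of_forall hg)

theorem integrable_of_abs_le {Ω : Type*} [MeasurableSpace Ω] {μ : Measure Ω}
    [IsFiniteMeasure μ] {g : Ω → ℝ} (hm : Measurable g) {C : ℝ} (hg : ∀ z, |g z| ≤ C) :
    Integrable g μ :=
  Integrable.of_bound hm.aestronglyMeasurable C (Eventually.of_forall hg)

section Bellman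

variable {X A W : Type*}
  [MetricSpace X] [SecondCountableTopology X] [MeasurableSpace X] [BorelSpace X]
  [MetricSpace A] [SecondCountableTopology A] [MeasurableSpace A] [BorelSpace A]
  [MetricSpace W] [SecondCountableTopology W] [MeasurableSpace W] [BorelSpace W]
  {f : X → A → W → X} {r : X → A → ℝ} {rmax α : ℝ}

theorem measurable_payoff (hr : Continuous fun p : X × A => r p.1 p.2)
    (hf : Continuous fun p : X × A × W => f p.1 p.2.1 p.2.2) (u : X →ᵇ ℝ) :
    Measurable fun p : X × A × W => r p.1 p.2.1 + α * u (f p.1 p.2.1 p.2.2) := by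
  have h1 : Continuous fun p : X × A × W => r p.1 p.2.1 :=
    hr.comp (continuous_fst.prodMk (continuous_fst.comp continuous_snd))
  exact (h1.add (continuous_const.mul (u.continuous.comp hf))).measurable

theorem abs_payoff_le (hα0 : 0 < α) (hr_bdd : ∀ x a, 0 ≤ r x a ∧ r x a ≤ rmax) (u : X →ᵇ ℝ)
    (x : X) (a : A) (w : W) : |r x a + α * u (f x a w)| ≤ rmax + α * ‖u‖ := by
  refine (abs_add_le _ _).trans (add_le_add ?_ ?_)
  · rw [abs_of_nonneg (hr_bdd x a).1]; exact (hr_bdd x a).2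
  · rw [abs_mul, abs_of_pos hα0]
    exact mul_le_mul_of_nonneg_left (u.norm_coe_le_norm _) hα0.le

theorem integrable_payoff (hα0 : 0 < α) (hr_bdd : ∀ x a, 0 ≤ r x a ∧ r x a ≤ rmax)
    (hr : Continuous fun p : X × A => r p.1 p.2)
    (hf : Continuous fun p : X × A × W => f p.1 p.2.1 p.2.2) (u : X →ᵇ ℝ) (x : X)
    (μ : Measure (A × W)) [IsFiniteMeasure μ] :
    Integrable (fun z : A × W => r x z.1 + α * u (f x z.1 z.2)) μ :=
  integrable_of_abs_le ((measurable_payoff hr hf u).comp measurable_prodMk_left)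
    fun z => abs_payoff_le hα0 hr_bdd u x z.1 z.2

theorem abs_stage_le (hα0 : 0 < α) (hr_bdd : ∀ x a, 0 ≤ r x a ∧ r x a ≤ rmax) (u : X →ᵇ ℝ)
    (x : X) (φ : ProbabilityMeasure A) (ψ : ProbabilityMeasure W) :
    |stage f r α u x φ ψ| ≤ rmax + α * ‖u‖ :=
  abs_integral_le_of_abs_le fun _ => abs_payoff_le hα0 hr_bdd u _ _ _

theorem abs_stage_sub_le (hα0 : 0 < α) (hr_bdd : ∀ x a, 0 ≤ r x a ∧ r x a ≤ rmax)
    (hr : Continuous fun p : X × A => r p.1 p.2)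
    (hf : Continuous fun p : X × A × W => f p.1 p.2.1 p.2.2) (u v : X →ᵇ ℝ) (x : X)
    (φ : ProbabilityMeasure A) (ψ : ProbabilityMeasure W) :
    |stage f r α u x φ ψ - stage f r α v x φ ψ| ≤ α * ‖u - v‖ := by
  rw [stage, stage, ← integral_sub (integrable_payoff hα0 hr_bdd hr hf u x _)
    (integrable_payoff hα0 hr_bdd hr hf v x _)]
  refine abs_integral_le_of_abs_le fun z => ?_
  rw [add_sub_add_left_eq_sub, ← mul_sub, abs_mul, abs_of_pos hα0]
  exact mul_le_mul_of_nonneg_left ((u - v).norm_coe_le_norm _) hα0.le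

/-- The one-stage payoff is uniformly continuous in the state, uniformly in the decisions. -/
theorem exists_forall_abs_stage_sub_le (hα0 : 0 < α) (hα1 : α < 1)
    (hr_bdd : ∀ x a, 0 ≤ r x a ∧ r x a ≤ rmax)
    (hr : UniformContinuous fun p : X × A => r p.1 p.2)
    (hf : UniformContinuous fun p : X × A × W => f p.1 p.2.1 p.2.2) {u : X →ᵇ ℝ}
    (hu : UniformContinuous u) {ε : ℝ} (hε : 0 < ε) :
    ∃ δ > 0, ∀ x y, dist x y < δ → ∀ (φ : ProbabilityMeasure A) (ψ : ProbabilityMeasure W),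
      |stage f r α u x φ ψ - stage f r α u y φ ψ| ≤ ε := by
  obtain ⟨δ₁, hδ₁, h₁⟩ := Metric.uniformContinuous_iff.1 hr (ε / 2) (half_pos hε)
  obtain ⟨δ₂, hδ₂, h₂⟩ := Metric.uniformContinuous_iff.1 (hu.comp hf) (ε / 2) (half_pos hε)
  refine ⟨min δ₁ δ₂, lt_min hδ₁ hδ₂, fun x y hxy φ ψ => ?_⟩
  rw [stage, stage, ← integral_sub
    (integrable_payoff hα0 hr_bdd hr.continuous hf.continuous u x _)
    (integrable_payoff hα0 hr_bdd hr.continuous hf.continuous u y _)]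
  refine abs_integral_le_of_abs_le fun z => ?_
  -- In the sup metric (x, a) and (y, a) are as far apart as x and y, so one modulus serves all a
  -- and w and survives integration against any φ × ψ.
  have e₁ : |r x z.1 - r y z.1| < ε / 2 :=
    @h₁ (x, z.1) (y, z.1) (by simpa [Prod.dist_eq] using (lt_min_iff.1 hxy).1)
  have e₂ : |u (f x z.1 z.2) - u (f y z.1 z.2)| < ε / 2 :=
    @h₂ (x, z) (y, z) (by simpa [Prod.dist_eq] using (lt_min_iff.1 hxy).2)
  have e₃ : |α * (u (f x z.1 z.2) - u (f y z.1 z.2))| ≤ ε / 2 := by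
    rw [abs_mul, abs_of_pos hα0]
    exact (mul_le_of_le_one_left (abs_nonneg _) hα1.le).trans e₂.le
  calc _ = |(r x z.1 - r y z.1) + α * (u (f x z.1 z.2) - u (f y z.1 z.2))| := by congr 1; ring
    _ ≤ ε := (abs_add_le _ _).trans (by linarith)

/-- For a fixed state and a fixed decision of the controller the one-stage payoff is continuous
in the decision of the adversary. -/
theorem tendsto_stage (hα0 : 0 < α) (hr_bdd : ∀ x a, 0 ≤ r x a ∧ r x a ≤ rmax)
    (hr : Continuous fun p : X × A => r p.1 p.2)
    (hf : Continuous fun p : X × A × W => f p.1 p.2.1 p.2.2) (u : X →ᵇ ℝ) (x : X)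
    (φ : ProbabilityMeasure A) {ψ : ProbabilityMeasure W} {D : ℕ → ProbabilityMeasure W}
    (hD : Tendsto D atTop (𝓝 ψ)) :
    Tendsto (fun n => stage f r α u x φ (D n)) atTop (𝓝 (stage f r α u x φ ψ)) := by
  -- Integrating the action out first leaves, by dominated convergence, a bounded continuous
  -- function of w, which weak convergence can test.
  let g : W → ℝ := fun w => ∫ a, (r x a + α * u (f x a w)) ∂(φ : Measure A)
  have hg : Continuous g := by
    refine continuous_of_dominated (bound := fun _ => rmax + α * ‖u‖) ?_ ?_
      (integrable_const _) ?_
    · intro w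
      exact ((measurable_payoff (α := α) hr hf u).comp
        (measurable_const.prodMk (measurable_id.prodMk measurable_const))).aestronglyMeasurable
    · exact fun w => Eventually.of_forall fun a => abs_payoff_le hα0 hr_bdd u x a w
    · refine Eventually.of_forall fun a => continuous_const.add (continuous_const.mul ?_)
      exact u.continuous.comp (hf.comp
        (continuous_const.prodMk (continuous_const.prodMk continuous_id)))
  let G : W →ᵇ ℝ := BoundedContinuousFunction.ofNormedAddCommGroup g hg (rmax + α * ‖u‖)
    fun w => abs_integral_le_of_abs_le fun a => abs_payoff_le hα0 hr_bdd u x a w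
  have key : ∀ ψ : ProbabilityMeasure W, stage f r α u x φ ψ = ∫ w, G w ∂(ψ : Measure W) :=
    fun ψ => integral_prod_symm _ (integrable_payoff hα0 hr_bdd hr hf u x _)
  simp_rw [key]
  exact ProbabilityMeasure.tendsto_iff_forall_integral_tendsto.1 hD G

/-- The rewards cancel in the difference of one-stage payoffs, leaving α(u - v) at the next state.
No uniform continuity is involved, so the estimate also yields uniqueness among all bounded
continuous functions. -/
theorem abs_cauBellman_sub_le (hα0 : 0 < α) (hr_bdd : ∀ x a, 0 ≤ r x a ∧ r x a ≤ rmax)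
    (hr : Continuous fun p : X × A => r p.1 p.2)
    (hf : Continuous fun p : X × A × W => f p.1 p.2.1 p.2.2)
    {Q : Set (ProbabilityMeasure A)} {P : Set (ProbabilityMeasure W)} (hQ : Q.Nonempty)
    (hP : P.Nonempty) (u v : X →ᵇ ℝ) (x : X) :
    |cauBellman f r α Q P u x - cauBellman f r α Q P v x| ≤ α * ‖u - v‖ := by
  have := hQ.to_subtype
  have := hP.to_subtype
  refine abs_iSup_iInf_sub_le (C := max (rmax + α * ‖u‖) (rmax + α * ‖v‖))
    (fun φ ψ => ?_) (fun φ ψ => ?_) fun φ ψ => ?_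
  · exact (abs_stage_le hα0 hr_bdd u x φ.1 ψ.1).trans (le_max_left _ _)
  · exact (abs_stage_le hα0 hr_bdd v x φ.1 ψ.1).trans (le_max_right _ _)
  · exact abs_stage_sub_le hα0 hr_bdd hr hf u v x φ.1 ψ.1

/-- The Bellman operator preserves bounded uniformly continuous functions. -/
theorem exists_uniformContinuous_eq_cauBellman (hα0 : 0 < α) (hα1 : α < 1)
    (hr_bdd : ∀ x a, 0 ≤ r x a ∧ r x a ≤ rmax)
    (hr : UniformContinuous fun p : X × A => r p.1 p.2)
    (hf : UniformContinuous fun p : X × A × W => f p.1 p.2.1 p.2.2)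
    {Q : Set (ProbabilityMeasure A)} {P : Set (ProbabilityMeasure W)} (hQ : Q.Nonempty)
    (hP : P.Nonempty) {u : X →ᵇ ℝ} (hu : UniformContinuous u) :
    ∃ v : X →ᵇ ℝ, UniformContinuous v ∧ ∀ x, v x = cauBellman f r α Q P u x := by
  have := hQ.to_subtype
  have := hP.to_subtype
  have huc : UniformContinuous (cauBellman f r α Q P u) := by
    refine Metric.uniformContinuous_iff.2 fun ε hε => ?_
    obtain ⟨δ, hδ, h⟩ :=
      exists_forall_abs_stage_sub_le hα0 hα1 hr_bdd hr hf hu (half_pos hε)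
    refine ⟨δ, hδ, fun x y hxy => lt_of_le_of_lt ?_ (half_lt_self hε)⟩
    exact abs_iSup_iInf_sub_le (fun φ ψ => abs_stage_le hα0 hr_bdd u x φ.1 ψ.1)
      (fun φ ψ => abs_stage_le hα0 hr_bdd u y φ.1 ψ.1) fun φ ψ => h x y hxy φ.1 ψ.1
  exact ⟨BoundedContinuousFunction.ofNormedAddCommGroup _ huc.continuous (rmax + α * ‖u‖)
    fun x => abs_iSup_le fun φ => abs_iInf_le fun ψ => abs_stage_le hα0 hr_bdd u x φ.1 ψ.1,
    huc, fun _ => rfl⟩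

/-- Uniform limits preserve uniform continuity; closedness supplies the completeness that Banach's
theorem requires. -/
theorem isClosed_setOf_uniformContinuous (X : Type*) [MetricSpace X] :
    IsClosed {u : X →ᵇ ℝ | UniformContinuous u} := by
  refine isClosed_of_closure_subset fun u hu => ?_
  refine uniformContinuous_of_uniform_approx_of_uniformContinuous fun s hs => ?_
  obtain ⟨ε, hε, hs⟩ := Metric.mem_uniformity_dist.1 hs
  obtain ⟨v, hv, huv⟩ := Metric.mem_closure_iff.1 hu ε hε
  exact ⟨v, hv, fun y => hs ((BoundedContinuousFunction.dist_coe_le_dist y).trans_lt huv)⟩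

/-- The contraction is run on uniformly continuous functions, which the operator is known to
preserve. The uniform continuity of the solution is needed again for the controller's selection. -/
theorem exists_uniformContinuous_fixedPoint (hα0 : 0 < α) (hα1 : α < 1)
    (hr_bdd : ∀ x a, 0 ≤ r x a ∧ r x a ≤ rmax)
    (hr : UniformContinuous fun p : X × A => r p.1 p.2)
    (hf : UniformContinuous fun p : X × A × W => f p.1 p.2.1 p.2.2)
    {Q : Set (ProbabilityMeasure A)} {P : Set (ProbabilityMeasure W)} (hQ : Q.Nonempty)
    (hP : P.Nonempty) :
    ∃ u : X →ᵇ ℝ, UniformContinuous u ∧ ∀ x, u x = cauBellman f r α Q P u x := by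
  choose T hT hTeq using fun u : {u : X →ᵇ ℝ | UniformContinuous u} =>
    exists_uniformContinuous_eq_cauBellman hα0 hα1 hr_bdd hr hf hQ hP u.2
  have : CompleteSpace {u : X →ᵇ ℝ | UniformContinuous u} :=
    (isClosed_setOf_uniformContinuous X).completeSpace_coe
  have : Nonempty {u : X →ᵇ ℝ | UniformContinuous u} := ⟨⟨0, uniformContinuous_const⟩⟩
  let S : {u : X →ᵇ ℝ | UniformContinuous u} → {u : X →ᵇ ℝ | UniformContinuous u} :=
    fun u => ⟨T u, hT u⟩
  have hS : ContractingWith ⟨α, hα0.le⟩ S := by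
    refine ⟨NNReal.coe_lt_coe.1 hα1, LipschitzWith.of_dist_le_mul fun u v => ?_⟩
    change dist (T u) (T v) ≤ α * dist u.1 v.1
    rw [BoundedContinuousFunction.dist_le (by positivity)]
    intro x
    rw [Real.dist_eq, hTeq, hTeq, dist_eq_norm]
    exact abs_cauBellman_sub_le hα0 hr_bdd hr.continuous hf.continuous hQ hP u.1 v.1 x
  refine ⟨(hS.fixedPoint S).1, (hS.fixedPoint S).2, fun x => ?_⟩
  rw [← hTeq]
  exact congrArg (fun v => v.1 x) hS.fixedPoint_isFixedPt.eq.symm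

theorem eq_of_eq_cauBellman (hα0 : 0 < α) (hα1 : α < 1)
    (hr_bdd : ∀ x a, 0 ≤ r x a ∧ r x a ≤ rmax)
    (hr : Continuous fun p : X × A => r p.1 p.2)
    (hf : Continuous fun p : X × A × W => f p.1 p.2.1 p.2.2)
    {Q : Set (ProbabilityMeasure A)} {P : Set (ProbabilityMeasure W)} (hQ : Q.Nonempty)
    (hP : P.Nonempty) {u v : X →ᵇ ℝ} (hu : ∀ x, u x = cauBellman f r α Q P u x)
    (hv : ∀ x, v x = cauBellman f r α Q P v x) : u = v := by
  have h : ‖u - v‖ ≤ α * ‖u - v‖ := by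
    refine (BoundedContinuousFunction.norm_le (by positivity)).2 fun x => ?_
    rw [BoundedContinuousFunction.sub_apply, hu, hv]
    exact abs_cauBellman_sub_le hα0 hr_bdd hr hf hQ hP u v x
  have : ‖u - v‖ = 0 := by nlinarith [norm_nonneg (u - v)]
  exact sub_eq_zero.1 (norm_eq_zero.1 this)

end Bellman

/-! ### Discounted sums along the canonical process -/

/-- A discounted sum of rewards is bounded by the initial value of a process whose discounted
drift compensates the reward up to `ε`. -/
theorem tsum_discounted_le {α ε C : ℝ} (hα0 : 0 < α) (hα1 : α < 1) {R U : ℕ → ℝ}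
    (hR : ∀ t, |R t| ≤ C) (hU : ∀ t, |U t| ≤ C) (h : ∀ t, R t + α * U (t + 1) ≤ U t + ε) :
    ∑' t, α ^ t * R t ≤ U 0 + ε / (1 - α) := by
  have hs : ∀ {V : ℕ → ℝ}, (∀ t, |V t| ≤ C) → Summable fun t => α ^ t * V t := fun {V} hV => by
    refine Summable.of_norm_bounded (g := fun t => α ^ t * C)
      ((summable_geometric_of_lt_one hα0.le hα1).mul_right C) fun t => ?_
    rw [Real.norm_eq_abs, abs_mul, abs_of_pos (pow_pos hα0 t)]
    exact mul_le_mul_of_nonneg_left (hV t) (pow_pos hα0 t).le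
  have hsU := hs hU
  have hsU' : Summable fun t => α ^ (t + 1) * U (t + 1) :=
    (summable_nat_add_iff (f := fun t => α ^ t * U t) 1).2 hsU
  have hg : Summable fun t : ℕ => α ^ t * ε :=
    (summable_geometric_of_lt_one hα0.le hα1).mul_right ε
  -- The differences α^t U_t - α^(t+1) U_(t+1) telescope to U_0, and the errors α^t ε sum to ε / (1
  -- - α).
  have h1 : ∑' t, α ^ t * R t ≤
      ∑' t, (α ^ t * U t - α ^ (t + 1) * U (t + 1) + α ^ t * ε) := by
    refine (hs hR).tsum_le_tsum (fun t => ?_) ((hsU.sub hsU').add hg)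
    have := mul_le_mul_of_nonneg_left (h t) (pow_pos hα0 t).le
    rw [pow_succ]
    linarith
  rw [(hsU.sub hsU').tsum_add hg, hsU.tsum_sub hsU', hsU.tsum_eq_zero_add, tsum_mul_right,
    tsum_geometric_of_lt_one hα0.le hα1] at h1
  rw [div_eq_inv_mul]
  linarith [h1]

/-! ### The process of triples and its one-step conditional laws -/

section Law

variable {X A W : Type*}
  [MetricSpace X] [SecondCountableTopology X] [MeasurableSpace X] [BorelSpace X]
  [MeasurableSpace A] [MeasurableSpace W]
  {f : X → A → W → X} (hf : Measurable fun p : X × A × W => f p.1 p.2.1 p.2.2)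
  (π : ControlPolicy X A) (γ : AdversaryPolicy X A W)

/-- The law of the triples `(X_t, A_t, W_t)_t` when `X_0 = x`. -/
noncomputable def tripleLaw (x : X) : Measure (ℕ → X × A × W) :=
  Kernel.trajMeasure (X := fun _ => X × A × W) (initialLaw (Measure.dirac x) π γ)
    (stepKernel f hf π γ)

instance (x : X) : IsProbabilityMeasure (tripleLaw hf π γ x) := by
  unfold tripleLaw; infer_instance

theorem map_zero_tripleLaw (x : X) :
    (tripleLaw hf π γ x).map (fun p => p 0) = initialLaw (Measure.dirac x) π γ := by
  have h1 : (fun p : ℕ → X × A × W => p 0) =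
      (fun q : Finset.Iic 0 → X × A × W => q ⟨0, by simp⟩) ∘ Preorder.frestrictLe 0 := rfl
  rw [h1, ← Measure.map_map (by fun_prop) (by fun_prop), tripleLaw, Kernel.trajMeasure,
    Measure.map_comp _ _ (by fun_prop), Kernel.traj_map_frestrictLe, Kernel.partialTraj_self,
    Measure.id_comp, Measure.map_map (by fun_prop) (by fun_prop)]
  exact Measure.map_id

theorem stepKernel_apply (t : ℕ) (q : Finset.Iic t → X × A × W) :
    stepKernel f hf π γ t q =
      (Measure.dirac (nextState f t q)).prod (decisionKernel π γ (t + 1) (nextHist f t q)) := by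
  rw [stepKernel, Kernel.prod_apply, Kernel.deterministic_apply, Kernel.comap_apply]

/-- The joint law of the triples up to t and the triple at t + 1 is a composition product with
`stepKernel`, whose state component is a Dirac mass at `nextState`. -/
theorem ae_succ_eq (x : X) :
    ∀ᵐ p ∂tripleLaw hf π γ x, ∀ t, (p (t + 1)).1 = f (p t).1 (p t).2.1 (p t).2.2 := by
  rw [ae_all_iff]
  intro t
  let E : Set ((Finset.Iic t → X × A × W) × (X × A × W)) := {z | z.2.1 = nextState f t z.1}
  have hE : MeasurableSet E := measurableSet_eq_fun (by fun_prop)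
    ((measurable_nextState hf t).comp measurable_fst)
  have hm : Measurable fun p : ℕ → X × A × W =>
      ((Preorder.frestrictLe t p : Finset.Iic t → X × A × W), p (t + 1)) := by fun_prop
  have h1 : ∀ᵐ z ∂((tripleLaw hf π γ x).map
      (Preorder.frestrictLe (π := fun _ => X × A × W) t) ⊗ₘ stepKernel f hf π γ t), z ∈ E := by
    refine (Measure.ae_compProd_iff hE).2 ?_
    refine Eventually.of_forall fun q => ?_
    rw [stepKernel_apply]
    have h2 : ∀ᵐ y ∂Measure.dirac (nextState f t q), y = nextState f t q := by
      exact (ae_dirac_iff (measurableSet_eq_fun measurable_id measurable_const)).2 rfl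
    exact Measure.quasiMeasurePreserving_fst.ae h2
  rw [tripleLaw, Kernel.map_frestrictLe_trajMeasure_compProd_eq_map_trajMeasure] at h1
  exact ae_of_ae_map hm.aemeasurable h1

/-- `policyValue` recomputes states from x_0 and the (a_t, w_t), while the triples store them; this
identification lets the estimates be made on `tripleLaw`. -/
theorem ae_state_eq (x : X) :
    ∀ᵐ p ∂tripleLaw hf π γ x, ∀ t, state f t ((p 0).1, fun t => (p t).2) = (p t).1 := by
  filter_upwards [ae_succ_eq hf π γ x] with p hp t
  induction t with
  | zero => rfl
  | succ t ih => rw [hp, ← ih]; rfl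

/-- Comparison of one-step expectations given the histories yields comparison of expectations. -/
theorem integral_tripleLaw_mono {g g' : X × A × W → ℝ} (hg : Measurable g) (hg' : Measurable g')
    {C : ℝ} (hgC : ∀ z, |g z| ≤ C) (hgC' : ∀ z, |g' z| ≤ C)
    (h : ∀ t (k : Hist X A t), ∫ z, g (k.2, z) ∂decisionKernel π γ t k ≤
      ∫ z, g' (k.2, z) ∂decisionKernel π γ t k) (x : X) (t : ℕ) :
    ∫ p, g (p t) ∂tripleLaw hf π γ x ≤ ∫ p, g' (p t) ∂tripleLaw hf π γ x := by
  -- The decision at time 0 sits in the initial law; the one at time t + 1 sits in `stepKernel` at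
  -- index t, so that case conditions on the triples up to t.
  cases t with
  | zero =>
    have key : ∀ g : X × A × W → ℝ, Measurable g → (∀ z, |g z| ≤ C) →
        ∫ p, g (p 0) ∂tripleLaw hf π γ x =
          ∫ z, g (x, z) ∂decisionKernel π γ 0 (Fin.elim0, x) := by
      intro g hg hgC
      rw [← integral_map (φ := fun p : ℕ → X × A × W => p 0)
        (measurable_pi_apply 0).aemeasurable
        hg.aestronglyMeasurable, map_zero_tripleLaw, initialLaw,
        Measure.integral_compProd (integrable_of_abs_le hg hgC), integral_dirac]
      rfl
    rw [key g hg hgC, key g' hg' hgC']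
    exact h 0 (Fin.elim0, x)
  | succ t =>
    let ν := (tripleLaw hf π γ x).map (Preorder.frestrictLe (π := fun _ => X × A × W) t)
    have : IsProbabilityMeasure ν := Measure.isProbabilityMeasure_map (by fun_prop)
    have key : ∀ g : X × A × W → ℝ, Measurable g → (∀ z, |g z| ≤ C) →
        ∫ p, g (p (t + 1)) ∂tripleLaw hf π γ x =
          ∫ q, ∫ y, g y ∂stepKernel f hf π γ t q ∂ν := by
      intro g hg hgC
      have hgs : Measurable fun z : (Finset.Iic t → X × A × W) × (X × A × W) => g z.2 :=
        hg.comp measurable_snd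
      rw [← Measure.integral_compProd (f := fun z => g z.2)
        (integrable_of_abs_le hgs fun z => hgC z.2)]
      dsimp only [ν]
      rw [tripleLaw, Kernel.map_frestrictLe_trajMeasure_compProd_eq_map_trajMeasure,
        integral_map (by fun_prop) hgs.aestronglyMeasurable]
    have hint : ∀ g : X × A × W → ℝ, Measurable g → (∀ z, |g z| ≤ C) →
        Integrable (fun q => ∫ y, g y ∂stepKernel f hf π γ t q) ν := fun g hg hgC =>
      integrable_of_abs_le (hg.stronglyMeasurable.integral_kernel).measurable
        fun q => abs_integral_le_of_abs_le hgC
    have hstep : ∀ g : X × A × W → ℝ, Measurable g → (∀ z, |g z| ≤ C) → ∀ q,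
        ∫ y, g y ∂stepKernel f hf π γ t q =
          ∫ z, g ((nextHist f t q).2, z) ∂decisionKernel π γ (t + 1) (nextHist f t q) := by
      intro g hg hgC q
      rw [stepKernel_apply, integral_prod _ (integrable_of_abs_le hg hgC), integral_dirac]
      rfl
    rw [key g hg hgC, key g' hg' hgC']
    refine integral_mono (hint g hg hgC) (hint g' hg' hgC') fun q => ?_
    dsimp only
    rw [hstep g hg hgC, hstep g' hg' hgC']
    exact h (t + 1) _

variable {r : X → A → ℝ} {rmax α : ℝ}

/-- The state becomes a coordinate of the triple, and the bound α^t `rmax` allows sum and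
expectation to be exchanged. -/
theorem policyValue_eq_tsum (hα0 : 0 < α) (hα1 : α < 1)
    (hr_bdd : ∀ x a, 0 ≤ r x a ∧ r x a ≤ rmax) (hr : Measurable fun p : X × A => r p.1 p.2)
    (x : X) :
    policyValue f hf r α (Measure.dirac x) π γ =
      ∑' t, α ^ t * ∫ p, r (p t).1 (p t).2.1 ∂tripleLaw hf π γ x := by
  have hrabs : ∀ x a, |r x a| ≤ rmax := fun x a => by
    rw [abs_of_nonneg (hr_bdd x a).1]; exact (hr_bdd x a).2
  have hstate : ∀ t, Measurable (state f t : Path X A W → X) := by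
    intro t
    induction t with
    | zero => exact measurable_fst
    | succ t ih =>
      have ht : Measurable fun ω : Path X A W => ω.2 t :=
        (measurable_pi_apply t).comp measurable_snd
      exact hf.comp (ih.prodMk (ht.fst.prodMk ht.snd))
  have hm : Measurable fun p : ℕ → X × A × W => ((p 0).1, fun t => (p t).2) := by fun_prop
  have hterm : ∀ t, Measurable fun ω : Path X A W => α ^ t * r (state f t ω) (action t ω) := by
    intro t
    have ht : Measurable fun ω : Path X A W => ω.2 t :=
      (measurable_pi_apply t).comp measurable_snd
    exact (hr.comp ((hstate t).prodMk ht.fst)).const_mul _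
  have hrt : ∀ t, Measurable fun p : ℕ → X × A × W => r (p t).1 (p t).2.1 := fun t =>
    hr.comp ((measurable_pi_apply t).fst.prodMk (measurable_pi_apply t).snd.fst)
  have h1 : policyValue f hf r α (Measure.dirac x) π γ =
      ∫ p, ∑' t, α ^ t * r (p t).1 (p t).2.1 ∂tripleLaw hf π γ x := by
    rw [policyValue, pathLaw, integral_map hm.aemeasurable
      (Measurable.tsum hterm).aestronglyMeasurable]
    refine integral_congr_ae ?_
    filter_upwards [ae_state_eq hf π γ x] with p hp
    simp only [hp]
    rfl
  have hint : ∀ t, Integrable (fun p : ℕ → X × A × W => r (p t).1 (p t).2.1)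
      (tripleLaw hf π γ x) := fun t => integrable_of_abs_le (hrt t) fun p => hrabs _ _
  rw [h1, ← integral_tsum_of_summable_integral_norm fun t => (hint t).const_mul (α ^ t)]
  · simp_rw [integral_const_mul]
  · refine Summable.of_norm_bounded (g := fun t => α ^ t * rmax)
      ((summable_geometric_of_lt_one hα0.le hα1).mul_right rmax) fun t => ?_
    refine abs_integral_le_of_abs_le fun p => ?_
    rw [abs_norm, Real.norm_eq_abs, abs_mul, abs_of_pos (pow_pos hα0 t)]
    exact mul_le_mul_of_nonneg_left (hrabs _ _) (pow_pos hα0 t).le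

/-- The geometric bound holds path by path; it keeps the suprema and infima in `drscValue` over
bounded families. -/
theorem abs_policyValue_le (hα0 : 0 < α) (hα1 : α < 1)
    (hr_bdd : ∀ x a, 0 ≤ r x a ∧ r x a ≤ rmax) (x : X) :
    |policyValue f hf r α (Measure.dirac x) π γ| ≤ (1 - α)⁻¹ * rmax := by
  have hm : Measurable fun p : ℕ → X × A × W => ((p 0).1, fun t => (p t).2) := by fun_prop
  have : IsProbabilityMeasure (pathLaw f hf (Measure.dirac x) π γ) :=
    Measure.isProbabilityMeasure_map (μ := tripleLaw hf π γ x) hm.aemeasurable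
  refine abs_integral_le_of_abs_le fun ω => ?_
  rw [← Real.norm_eq_abs]
  refine tsum_of_norm_bounded (g := fun t => α ^ t * rmax)
    ((hasSum_geometric_of_lt_one hα0.le hα1).mul_right rmax) fun t => ?_
  rw [Real.norm_eq_abs, abs_mul, abs_of_pos (pow_pos hα0 t), abs_of_nonneg (hr_bdd _ _).1]
  exact mul_le_mul_of_nonneg_left (hr_bdd _ _).2 (pow_pos hα0 t).le

/-! ### Verification: from one-step inequalities to values of policies -/

section Comparison

variable (hα0 : 0 < α) (hα1 : α < 1)
  (hr_bdd : ∀ x a, 0 ≤ r x a ∧ r x a ≤ rmax) (hr : Measurable fun p : X × A => r p.1 p.2)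
  (u : X →ᵇ ℝ)

include hα0 hα1 hr_bdd hr

omit hα1 hr in
theorem abs_payoff_add_le (z : X × A × W) :
    |r z.1 z.2.1 + α * u (f z.1 z.2.1 z.2.2)| ≤ rmax + α * ‖u‖ := by
  refine (abs_add_le _ _).trans (add_le_add ?_ ?_)
  · rw [abs_of_nonneg (hr_bdd _ _).1]; exact (hr_bdd _ _).2
  · rw [abs_mul, abs_of_pos hα0]
    exact mul_le_mul_of_nonneg_left (u.norm_coe_le_norm _) hα0.le

omit hα1 hα0 hr_bdd in
include hf in
theorem measurable_payoff_add :
    Measurable fun z : X × A × W => r z.1 z.2.1 + α * u (f z.1 z.2.1 z.2.2) :=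
  (hr.comp (measurable_fst.prodMk measurable_snd.fst)).add
    ((u.continuous.measurable.comp hf).const_mul α)

omit hα0 hα1 in
-- Since f(X_t, A_t, W_t) = X_(t+1) almost surely, the expected one-stage payoff takes the form R_t
-- + α U_(t+1) required by `tsum_discounted_le`.
theorem integral_payoff_tripleLaw (x : X) (t : ℕ) :
    ∫ p, (r (p t).1 (p t).2.1 + α * u (f (p t).1 (p t).2.1 (p t).2.2)) ∂tripleLaw hf π γ x =
      (∫ p, r (p t).1 (p t).2.1 ∂tripleLaw hf π γ x) +
        α * ∫ p, u (p (t + 1)).1 ∂tripleLaw hf π γ x := by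
  have h1 : Measurable fun p : ℕ → X × A × W => r (p t).1 (p t).2.1 :=
    hr.comp ((measurable_pi_apply t).fst.prodMk (measurable_pi_apply t).snd.fst)
  have h2 : Measurable fun p : ℕ → X × A × W => u (f (p t).1 (p t).2.1 (p t).2.2) :=
    (u.continuous.measurable.comp hf).comp (measurable_pi_apply t)
  rw [integral_add (integrable_of_abs_le h1 (C := rmax) fun p => ?_)
    ((integrable_of_abs_le h2 fun p => u.norm_coe_le_norm _).const_mul α), integral_const_mul]
  · congr 2
    refine integral_congr_ae ?_
    filter_upwards [ae_succ_eq hf π γ x] with p hp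
    rw [hp t]
  · rw [abs_of_nonneg (hr_bdd _ _).1]; exact (hr_bdd _ _).2

omit hα0 hα1 hr_bdd hr in
theorem integral_add_const_tripleLaw (x : X) (t : ℕ) (c : ℝ) :
    ∫ p, (u (p t).1 + c) ∂tripleLaw hf π γ x = (∫ p, u (p t).1 ∂tripleLaw hf π γ x) + c := by
  have h2 : Measurable fun p : ℕ → X × A × W => u (p t).1 :=
    u.continuous.measurable.comp (measurable_pi_apply t).fst
  rw [integral_add (integrable_of_abs_le h2 fun p => u.norm_coe_le_norm _) (integrable_const _)]
  simp

omit hα0 hα1 hr_bdd hr in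
theorem integral_zero_tripleLaw (x : X) : ∫ p, u (p 0).1 ∂tripleLaw hf π γ x = u x := by
  have h2 : Measurable fun z : X × A × W => u z.1 := u.continuous.measurable.comp measurable_fst
  rw [← integral_map (φ := fun p : ℕ → X × A × W => p 0) (f := fun z => u z.1)
    (measurable_pi_apply 0).aemeasurable h2.aestronglyMeasurable, map_zero_tripleLaw, initialLaw,
    ← integral_map (φ := Prod.fst) measurable_fst.aemeasurable
      u.continuous.measurable.aestronglyMeasurable]
  change ∫ y, u y ∂(Measure.fst _) = _
  rw [Measure.fst_compProd, integral_dirac]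

omit hα0 hα1 hr_bdd hr in
theorem abs_add_const_le (c : ℝ) (z : X × A × W) : |u z.1 + c| ≤ ‖u‖ + |c| :=
  (abs_add_le _ _).trans (add_le_add_left (u.norm_coe_le_norm _) _)

/-- If the one-stage payoffs with terminal reward `u` are at most `u + ε` along all histories, then
the value of the pair of policies is at most `u(x) + ε / (1 - α)`. -/
theorem policyValue_le {ε : ℝ}
    (h : ∀ t (k : Hist X A t), ∫ z, (r k.2 z.1 + α * u (f k.2 z.1 z.2)) ∂decisionKernel π γ t k ≤
      u k.2 + ε) (x : X) :
    policyValue f hf r α (Measure.dirac x) π γ ≤ u x + ε / (1 - α) := by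
  rw [policyValue_eq_tsum hf π γ hα0 hα1 hr_bdd hr, ← integral_zero_tripleLaw hf π γ u x]
  refine tsum_discounted_le (C := max rmax ‖u‖) hα0 hα1
    (U := fun t => ∫ p, u (p t).1 ∂tripleLaw hf π γ x) (fun t => ?_) (fun t => ?_) fun t => ?_
  · refine (abs_integral_le_of_abs_le fun p => ?_).trans (le_max_left _ _)
    rw [abs_of_nonneg (hr_bdd _ _).1]; exact (hr_bdd _ _).2
  · exact (abs_integral_le_of_abs_le fun p => u.norm_coe_le_norm _).trans (le_max_right _ _)
  · rw [← integral_payoff_tripleLaw hf π γ hr_bdd hr, ← integral_add_const_tripleLaw]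
    refine integral_tripleLaw_mono hf π γ (measurable_payoff_add hf hr u)
      (g' := fun z => u z.1 + ε) ((u.continuous.measurable.comp measurable_fst).add_const ε)
      (C := max (rmax + α * ‖u‖) (‖u‖ + |ε|))
      (fun z => (abs_payoff_add_le hα0 hr_bdd u z).trans (le_max_left _ _))
      (fun z => (abs_add_const_le u ε z).trans (le_max_right _ _)) (fun t k => ?_) x t
    simpa using h t k

/-- If the one-stage payoffs with terminal reward `u` are at least `u - ε` along all histories,
then the value of the pair of policies is at least `u(x) - ε / (1 - α)`. -/
theorem le_policyValue {ε : ℝ}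
    (h : ∀ t (k : Hist X A t), u k.2 - ε ≤
      ∫ z, (r k.2 z.1 + α * u (f k.2 z.1 z.2)) ∂decisionKernel π γ t k) (x : X) :
    u x - ε / (1 - α) ≤ policyValue f hf r α (Measure.dirac x) π γ := by
  rw [policyValue_eq_tsum hf π γ hα0 hα1 hr_bdd hr, ← integral_zero_tripleLaw hf π γ u x]
  -- The lower bound is the upper telescoping bound for the negated sequences -R and -U.
  have key : ∑' t, α ^ t * -(∫ p, r (p t).1 (p t).2.1 ∂tripleLaw hf π γ x) ≤
      -(∫ p, u (p 0).1 ∂tripleLaw hf π γ x) + ε / (1 - α) := by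
    refine tsum_discounted_le (C := max rmax ‖u‖) hα0 hα1
      (U := fun t => -(∫ p, u (p t).1 ∂tripleLaw hf π γ x)) (fun t => ?_) (fun t => ?_)
      fun t => ?_
    · rw [abs_neg]
      refine (abs_integral_le_of_abs_le fun p => ?_).trans (le_max_left _ _)
      rw [abs_of_nonneg (hr_bdd _ _).1]; exact (hr_bdd _ _).2
    · rw [abs_neg]
      exact (abs_integral_le_of_abs_le fun p => u.norm_coe_le_norm _).trans (le_max_right _ _)
    · have h1 := integral_payoff_tripleLaw hf π γ hr_bdd hr u x t (α := α)
      have h2 := integral_add_const_tripleLaw hf π γ u x t (-ε)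
      have h3 := integral_tripleLaw_mono hf π γ (g := fun z => u z.1 + -ε)
        ((u.continuous.measurable.comp measurable_fst).add_const (-ε))
        (measurable_payoff_add hf hr u) (C := max (rmax + α * ‖u‖) (‖u‖ + |-ε|))
        (fun z => (abs_add_const_le u (-ε) z).trans (le_max_right _ _))
        (fun z => (abs_payoff_add_le hα0 hr_bdd u z).trans (le_max_left _ _))
        (fun t k => by simpa [sub_eq_add_neg] using h t k) x t
      linarith
  simp only [mul_neg, tsum_neg] at key
  linarith

end Comparison

end Law

/-! ### Nearly optimal measurable decisions -/

section Selection

variable {X A W : Type*}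
  [MetricSpace X] [SecondCountableTopology X] [MeasurableSpace X] [BorelSpace X]
  [MetricSpace A] [SecondCountableTopology A] [MeasurableSpace A] [BorelSpace A]
  [MetricSpace W] [SecondCountableTopology W] [MeasurableSpace W] [BorelSpace W]
  {f : X → A → W → X} {r : X → A → ℝ} {rmax α : ℝ}
  {Q : Set (ProbabilityMeasure A)} {P : Set (ProbabilityMeasure W)}

/-- The controller has a nearly optimal decision that is a measurable function of the state. -/
theorem exists_measurable_controller_decision (hα0 : 0 < α) (hα1 : α < 1)
    (hr_bdd : ∀ x a, 0 ≤ r x a ∧ r x a ≤ rmax)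
    (hr : UniformContinuous fun p : X × A => r p.1 p.2)
    (hf : UniformContinuous fun p : X × A × W => f p.1 p.2.1 p.2.2)
    (hQ : Q.Nonempty) (hP : P.Nonempty) {u : X →ᵇ ℝ} (hu : UniformContinuous u)
    (heq : ∀ x, u x = cauBellman f r α Q P u x) {ε : ℝ} (hε : 0 < ε) :
    ∃ φ : X → ProbabilityMeasure A, Measurable φ ∧ (∀ x, φ x ∈ Q) ∧
      ∀ x, ∀ ψ ∈ P, u x - ε ≤ stage f r α u x (φ x) ψ := by
  rcases isEmpty_or_nonempty X with hX | hX
  · exact ⟨fun x => hX.elim x, measurable_of_empty _, fun x => hX.elim x, fun x => hX.elim x⟩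
  have := hQ.to_subtype
  have := hP.to_subtype
  -- A third of ε pays for near-optimality at a dense point, a third for moving the payoff from
  -- there to x, and a third for moving `u`.
  have h1 : ∀ x, ∃ φ ∈ Q, ∀ ψ ∈ P, u x - ε / 3 ≤ stage f r α u x φ ψ := by
    intro x
    have hlt : u x - ε / 3 < ⨆ φ : Q, ⨅ ψ : P, stage f r α u x φ.1 ψ.1 := by
      rw [← cauBellman_eq, ← heq]; linarith
    obtain ⟨φ, hφ⟩ := exists_lt_of_lt_ciSup hlt
    exact ⟨φ.1, φ.2, fun ψ hψ => hφ.le.trans (ciInf_le (bddBelow_range_of_abs_le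
      fun ψ : P => abs_stage_le hα0 hr_bdd u x φ.1 ψ.1) ⟨ψ, hψ⟩)⟩
  choose φ hφQ hφ using h1
  obtain ⟨δ₁, hδ₁, hs⟩ :=
    exists_forall_abs_stage_sub_le hα0 hα1 hr_bdd hr hf hu (show 0 < ε / 3 by linarith)
  obtain ⟨δ₂, hδ₂, hu'⟩ := Metric.uniformContinuous_iff.1 hu (ε / 3) (by linarith)
  -- The radius is uniform in the decisions, so the decision chosen at `c n` serves the whole ball
  -- around `c n`.
  let c := TopologicalSpace.denseSeq X
  obtain ⟨s, hsm, hsc⟩ := exists_measurable_choice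
    (E := fun n => Metric.ball (c n) (min δ₁ δ₂)) (fun n => measurableSet_ball)
    (fun x => by
      obtain ⟨n, hn⟩ := (TopologicalSpace.denseRange_denseSeq X).exists_dist_lt x
        (lt_min hδ₁ hδ₂)
      exact ⟨n, hn⟩) fun n => φ (c n)
  refine ⟨s, hsm, fun x => ?_, fun x ψ hψ => ?_⟩
  · obtain ⟨n, -, hn⟩ := hsc x
    exact hn ▸ hφQ _
  · obtain ⟨n, hx, hn⟩ := hsc x
    rw [hn]
    have hx' : dist x (c n) < min δ₁ δ₂ := hx
    have e1 := (abs_le.1 (hs x (c n) (hx'.trans_le (min_le_left _ _)) (φ (c n)) ψ)).1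
    have e2 := hφ (c n) ψ hψ
    have e3 := hu' (hx'.trans_le (min_le_right _ _))
    rw [Real.dist_eq] at e3
    linarith [(abs_lt.1 e3).2]

/-- Reading the coordinate φ as a kernel on X × Q turns joint measurability in (x, φ) into
measurability of a kernel integral. -/
theorem measurable_stage (hr : Continuous fun p : X × A => r p.1 p.2)
    (hf : Continuous fun p : X × A × W => f p.1 p.2.1 p.2.2) (u : X →ᵇ ℝ)
    (ψ : ProbabilityMeasure W) :
    Measurable fun z : X × Q => stage f r α u z.1 z.2.1 ψ := by
  let κ : Kernel (X × Q) A :=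
    ⟨fun z => (z.2.1 : Measure A),
      measurable_subtype_coe.comp (measurable_subtype_coe.comp measurable_snd)⟩
  have : IsMarkovKernel κ := ⟨fun z => z.2.1.prop⟩
  have h1 : Measurable fun p : (X × Q) × A × W =>
      r p.1.1 p.2.1 + α * u (f p.1.1 p.2.1 p.2.2) :=
    (measurable_payoff hr hf u).comp (measurable_fst.fst.prodMk measurable_snd)
  have h2 := (h1.stronglyMeasurable.integral_kernel_prod_right'
    (κ := κ ×ₖ Kernel.const (X × Q) (ψ : Measure W))).measurable
  convert! h2 using 2 with z
  rw [Kernel.prod_apply, Kernel.const_apply]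
  rfl

/-- The adversary has a nearly optimal reply that is a measurable function of the state and of the
decision of the controller. -/
theorem exists_measurable_adversary_reply (hα0 : 0 < α)
    (hr_bdd : ∀ x a, 0 ≤ r x a ∧ r x a ≤ rmax)
    (hr : Continuous fun p : X × A => r p.1 p.2)
    (hf : Continuous fun p : X × A × W => f p.1 p.2.1 p.2.2)
    (hP : P.Nonempty) {u : X →ᵇ ℝ}
    (heq : ∀ x, u x = cauBellman f r α Q P u x) {ε : ℝ} (hε : 0 < ε) :
    ∃ S : X × Q → ProbabilityMeasure W, Measurable S ∧ (∀ z, S z ∈ P) ∧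
      ∀ z, stage f r α u z.1 z.2.1 (S z) ≤ u z.1 + ε := by
  have := hP.to_subtype
  obtain ⟨D, hDP, hD⟩ := exists_seq_dense_probabilityMeasure hP
  obtain ⟨S, hSm, hS⟩ := exists_measurable_choice
    (E := fun n => {z : X × Q | stage f r α u z.1 z.2.1 (D n) ≤ u z.1 + ε})
    (fun n => measurableSet_le (measurable_stage hr hf u (D n))
      ((u.continuous.measurable.comp measurable_fst).add_const ε))
    (fun z => by
      -- Whatever φ is, its infimum is at most the sup-inf u(x), so some reply in `P` lies strictly
      -- below u(x) + ε; continuity in ψ then passes this on to a member of the dense sequence.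
      have hlt : ⨅ ψ : P, stage f r α u z.1 z.2.1 ψ.1 < u z.1 + ε := by
        refine lt_of_le_of_lt ?_ (lt_add_of_pos_right _ hε)
        rw [heq, cauBellman_eq]
        exact le_ciSup (f := fun φ : Q => ⨅ ψ : P, stage f r α u z.1 φ.1 ψ.1)
          (bddAbove_range_of_abs_le fun φ : Q => abs_iInf_le fun ψ : P =>
            abs_stage_le hα0 hr_bdd u z.1 φ.1 ψ.1) z.2
      obtain ⟨ψ, hψ⟩ := exists_lt_of_ciInf_lt hlt
      obtain ⟨k, hk⟩ := hD ψ.1 ψ.2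
      obtain ⟨n, hn⟩ :=
        ((tendsto_stage hα0 hr_bdd hr hf u z.1 z.2.1 hk).eventually_lt_const hψ).exists
      exact ⟨k n, hn.le⟩) D
  refine ⟨S, hSm, fun z => ?_, fun z => ?_⟩
  · obtain ⟨n, -, hn⟩ := hS z
    exact hn ▸ hDP n
  · obtain ⟨n, hz, hn⟩ := hS z
    rw [hn]
    exact hz

end Selection

/-! ### Policies -/

section Policy

variable {X A W : Type*} [MeasurableSpace X] [MeasurableSpace A] [MeasurableSpace W]
  {Q : Set (ProbabilityMeasure A)} {P : Set (ProbabilityMeasure W)}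

/-- With γ_t constant in the action, the composition product of kernels reduces to a product
measure; `a` merely names the constant value. -/
theorem decisionKernel_apply_of_isCAU (π : ControlPolicy X A) {γ : AdversaryPolicy X A W}
    (hγ : γ.IsCAU) (t : ℕ) (h : Hist X A t) (a : A) :
    decisionKernel π γ t h =
      (π.decision t h : Measure A).prod (γ.decision t (h, a) : Measure W) := by
  have h1 : (γ.kernel t).sectR h = Kernel.const A (γ.decision t (h, a) : Measure W) := by
    ext a' : 1
    exact congrArg (fun ψ : ProbabilityMeasure W => (ψ : Measure W)) (hγ t h a' a)
  rw [decisionKernel, Kernel.compProd_apply_eq_compProd_sectR, h1, Measure.compProd_const]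
  rfl

/-- The stationary policy of the controller with the decision function `φ`. -/
def ControlPolicy.ofState (φ : X → ProbabilityMeasure A) (hφ : Measurable φ) :
    ControlPolicy X A where
  decision _ h := φ h.2
  measurable_decision _ := hφ.comp measurable_snd

theorem ControlPolicy.ofState_mem_PiS {φ : X → ProbabilityMeasure A} {hφ : Measurable φ}
    (h : ∀ x, φ x ∈ Q) : ControlPolicy.ofState φ hφ ∈ PiS X Q :=
  ⟨fun _ k => h k.2, fun _ _ _ _ _ => rfl⟩

theorem PiS_subset_PiM : PiS X Q ⊆ PiM X Q :=
  fun _ hπ => ⟨hπ.1, fun t g g' x => hπ.2 t t g g' x⟩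

theorem PiM_subset_PiH : PiM X Q ⊆ PiH X Q := fun _ hπ => hπ.1

theorem GammaBarS_subset_GammaBarM : GammaBarS X A P ⊆ GammaBarM X A P :=
  fun _ hγ => ⟨hγ.1, fun t g g' x a => hγ.2 t t g g' x a⟩

theorem GammaBarM_subset_GammaBarH : GammaBarM X A P ⊆ GammaBarH X A P := fun _ hγ => hγ.1

theorem GammaBarS_nonempty (hP : P.Nonempty) : (GammaBarS X A P).Nonempty := by
  obtain ⟨ψ, hψ⟩ := hP
  exact ⟨⟨fun _ _ => ψ, fun _ => measurable_const⟩, ⟨fun _ _ => hψ, fun _ _ _ _ => rfl⟩,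
    fun _ _ _ _ _ _ => rfl⟩

/-- The policy of the adversary that replies by `S` to the state and to the controller's
decision. -/
def AdversaryPolicy.ofReply (S : X × Q → ProbabilityMeasure W) (hS : Measurable S)
    (π : ControlPolicy X A) (hπ : π ∈ PiH X Q) : AdversaryPolicy X A W where
  decision t g := S (g.1.2, ⟨π.decision t g.1, hπ t g.1⟩)
  measurable_decision t := hS.comp (measurable_fst.snd.prodMk
    ((π.measurable_decision t).comp measurable_fst).subtype_mk)

variable {S : X × Q → ProbabilityMeasure W} {hS : Measurable S} {π : ControlPolicy X A}

/-- The reply uses the controller's distribution but not the action drawn from it. It sees the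
history only through x_t and that distribution, hence the Markov and stationary versions that
follow. -/
theorem AdversaryPolicy.ofReply_mem_GammaBarH (hSP : ∀ z, S z ∈ P) (hπ : π ∈ PiH X Q) :
    AdversaryPolicy.ofReply S hS π hπ ∈ GammaBarH X A P :=
  ⟨fun _ _ => hSP _, fun _ _ _ _ => rfl⟩

theorem AdversaryPolicy.ofReply_mem_GammaBarM (hSP : ∀ z, S z ∈ P) (hπ : π ∈ PiM X Q) :
    AdversaryPolicy.ofReply S hS π hπ.1 ∈ GammaBarM X A P := by
  refine ⟨AdversaryPolicy.ofReply_mem_GammaBarH hSP hπ.1, fun t g g' x a => ?_⟩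
  simp only [AdversaryPolicy.ofReply, hπ.2 t g g' x]

theorem AdversaryPolicy.ofReply_mem_GammaBarS (hSP : ∀ z, S z ∈ P) (hπ : π ∈ PiS X Q) :
    AdversaryPolicy.ofReply S hS π hπ.1 ∈ GammaBarS X A P := by
  refine ⟨AdversaryPolicy.ofReply_mem_GammaBarH hSP hπ.1, fun s t g g' x a => ?_⟩
  simp only [AdversaryPolicy.ofReply, hπ.2 s t g g' x]

end Policy

/-! ### Max-min values -/

section Value

variable {X A W : Type*}
  [MetricSpace X] [SecondCountableTopology X] [MeasurableSpace X] [BorelSpace X]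
  [MetricSpace A] [SecondCountableTopology A] [MeasurableSpace A] [BorelSpace A]
  [MetricSpace W] [SecondCountableTopology W] [MeasurableSpace W] [BorelSpace W]
  {f : X → A → W → X} {r : X → A → ℝ} {rmax α : ℝ}

/-- The max-min value is `v` as soon as both players can guarantee `v` up to any `ε > 0`. -/
theorem drscValue_eq (hf : Measurable fun p : X × A × W => f p.1 p.2.1 p.2.2)
    (hα0 : 0 < α) (hα1 : α < 1) (hr_bdd : ∀ x a, 0 ≤ r x a ∧ r x a ≤ rmax) (x : X) {v : ℝ}
    {Pi : Set (ControlPolicy X A)} {Gam : Set (AdversaryPolicy X A W)} (hGam : Gam.Nonempty)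
    (hle : ∀ ε > 0, ∃ π ∈ Pi, ∀ γ ∈ Gam, v - ε ≤ policyValue f hf r α (Measure.dirac x) π γ)
    (hge : ∀ ε > 0, ∀ π ∈ Pi, ∃ γ ∈ Gam, policyValue f hf r α (Measure.dirac x) π γ ≤ v + ε) :
    v = drscValue f hf r α x Pi Gam := by
  have := hGam.to_subtype
  have hPi : Nonempty Pi := by
    obtain ⟨π, hπ, -⟩ := hle 1 one_pos
    exact ⟨⟨π, hπ⟩⟩
  have hb : ∀ (π : Pi) (γ : Gam), |policyValue f hf r α (Measure.dirac x) π.1 γ.1| ≤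
      (1 - α)⁻¹ * rmax := fun π γ => abs_policyValue_le hf π.1 γ.1 hα0 hα1 hr_bdd x
  refine le_antisymm (le_of_forall_pos_le_add fun ε hε => ?_)
    (ciSup_le fun π => le_of_forall_pos_le_add fun ε hε => ?_)
  · obtain ⟨π, hπ, h⟩ := hle ε hε
    rw [← sub_le_iff_le_add]
    exact (le_ciInf fun γ : Gam => h γ.1 γ.2).trans
      (le_ciSup (f := fun π : Pi => ⨅ γ : Gam, policyValue f hf r α (Measure.dirac x) π.1 γ.1)
        (bddAbove_range_of_abs_le fun π => abs_iInf_le (hb π)) ⟨π, hπ⟩)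
  · obtain ⟨γ, hγ, h⟩ := hge ε hε π.1 π.2
    exact (ciInf_le (bddBelow_range_of_abs_le (hb π)) ⟨γ, hγ⟩).trans h

variable [Nonempty A] {Q : Set (ProbabilityMeasure A)} {P : Set (ProbabilityMeasure W)}

/-- A stationary policy of the controller guarantees the solution of the Bellman equation up to
`ε`. -/
theorem exists_mem_PiS_forall_le_policyValue (hα0 : 0 < α) (hα1 : α < 1)
    (hr_bdd : ∀ x a, 0 ≤ r x a ∧ r x a ≤ rmax)
    (hr : UniformContinuous fun p : X × A => r p.1 p.2)
    (hf : UniformContinuous fun p : X × A × W => f p.1 p.2.1 p.2.2)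
    (hQ : Q.Nonempty) (hP : P.Nonempty) {u : X →ᵇ ℝ} (hu : UniformContinuous u)
    (heq : ∀ x, u x = cauBellman f r α Q P u x) (x : X) {ε : ℝ} (hε : 0 < ε) :
    ∃ π ∈ PiS X Q, ∀ γ ∈ GammaBarH X A P,
      u x - ε ≤ policyValue f hf.continuous.measurable r α (Measure.dirac x) π γ := by
  have h1 : 0 < 1 - α := sub_pos.2 hα1
  -- A one-step error of ε(1 - α) accumulates to ε under discounting.
  obtain ⟨φ, hφm, hφQ, hφ⟩ := exists_measurable_controller_decision hα0 hα1 hr_bdd hr hf hQ hP hu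
    heq (mul_pos hε h1)
  refine ⟨_, ControlPolicy.ofState_mem_PiS (hφ := hφm) hφQ, fun γ hγ => ?_⟩
  have h2 := le_policyValue hf.continuous.measurable (ControlPolicy.ofState φ hφm) γ hα0 hα1 hr_bdd
    hr.continuous.measurable u (ε := ε * (1 - α)) (fun t k => ?_) x
  · rwa [mul_div_cancel_right₀ _ h1.ne'] at h2
  · rw [decisionKernel_apply_of_isCAU _ hγ.2 t k (Classical.arbitrary A)]
    exact hφ k.2 _ (hγ.1 t _)

/-- The reply of the adversary keeps the value below the solution of the Bellman equation up to
`ε`. -/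
theorem policyValue_ofReply_le (hα0 : 0 < α) (hα1 : α < 1)
    (hr_bdd : ∀ x a, 0 ≤ r x a ∧ r x a ≤ rmax)
    (hr : Continuous fun p : X × A => r p.1 p.2)
    (hf : Measurable fun p : X × A × W => f p.1 p.2.1 p.2.2) {u : X →ᵇ ℝ} {ε : ℝ}
    {S : X × Q → ProbabilityMeasure W} (hS : Measurable S) (hSP : ∀ z, S z ∈ P)
    (h : ∀ z, stage f r α u z.1 z.2.1 (S z) ≤ u z.1 + ε * (1 - α)) (x : X)
    {π : ControlPolicy X A} (hπ : π ∈ PiH X Q) :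
    policyValue f hf r α (Measure.dirac x) π (AdversaryPolicy.ofReply S hS π hπ) ≤ u x + ε := by
  have h1 : 0 < 1 - α := sub_pos.2 hα1
  have h2 := policyValue_le hf π (AdversaryPolicy.ofReply S hS π hπ) hα0 hα1 hr_bdd
    hr.measurable u (ε := ε * (1 - α)) (fun t k => ?_) x
  · rwa [mul_div_cancel_right₀ _ h1.ne'] at h2
  · rw [decisionKernel_apply_of_isCAU _ (AdversaryPolicy.ofReply_mem_GammaBarH hSP hπ).2 t k
      (Classical.arbitrary A)]
    exact h (k.2, ⟨π.decision t k, hπ t k⟩)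

end Value

end DRSC

/-! ### Equality of the six values -/

open DRSC in
theorem mainTheorem7 {X A W : Type*}
    [MetricSpace X] [CompleteSpace X] [SecondCountableTopology X]
    [MeasurableSpace X] [BorelSpace X]
    [MetricSpace A] [CompleteSpace A] [SecondCountableTopology A]
    [MeasurableSpace A] [BorelSpace A] [Nonempty A]
    [MetricSpace W] [CompleteSpace W] [SecondCountableTopology W]
    [MeasurableSpace W] [BorelSpace W]
    (f : X → A → W → X) (r : X → A → ℝ) (rmax α : ℝ)
    (Q : Set (ProbabilityMeasure A)) (P : Set (ProbabilityMeasure W))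
    (hα0 : 0 < α) (hα1 : α < 1)
    (hr_bdd : ∀ x a, 0 ≤ r x a ∧ r x a ≤ rmax)
    (hr : UniformContinuous fun p : X × A => r p.1 p.2)
    (hf : UniformContinuous fun p : X × A × W => f p.1 p.2.1 p.2.2)
    (hQ : MeasurableSet Q) (hP : MeasurableSet P) (hP_ne : P.Nonempty)
    (hQ_dirac : ∀ a : A, (⟨Measure.dirac a, inferInstance⟩ : ProbabilityMeasure A) ∈ Q) :
    ∃ u : X →ᵇ ℝ,
      (∀ x, u x = cauBellman f r α Q P u x) ∧
      (∀ u' : X →ᵇ ℝ, (∀ x, u' x = cauBellman f r α Q P u' x) → u' = u) ∧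
      ∀ x,
        u x = drscValue f hf.continuous.measurable r α x (PiH X Q) (GammaBarH X A P) ∧
        u x = drscValue f hf.continuous.measurable r α x (PiM X Q) (GammaBarH X A P) ∧
        u x = drscValue f hf.continuous.measurable r α x (PiM X Q) (GammaBarM X A P) ∧
        u x = drscValue f hf.continuous.measurable r α x (PiS X Q) (GammaBarH X A P) ∧
        u x = drscValue f hf.continuous.measurable r α x (PiS X Q) (GammaBarM X A P) ∧
        u x = drscValue f hf.continuous.measurable r α x (PiS X Q) (GammaBarS X A P) := by
  have hQ_ne : Q.Nonempty := ⟨_, hQ_dirac (Classical.arbitrary A)⟩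
  obtain ⟨u, huc, hu⟩ := exists_uniformContinuous_fixedPoint hα0 hα1 hr_bdd hr hf hQ_ne hP_ne
  refine ⟨u, hu, fun u' hu' =>
    eq_of_eq_cauBellman hα0 hα1 hr_bdd hr.continuous hf.continuous hQ_ne hP_ne hu' hu,
    fun x => ?_⟩
  -- The six pairs share what matters: `Pi` contains the stationary policies, `Gam` contains only
  -- CAU adversaries, and replies to policies in `Pi` remain in `Gam`. The inclusion of `GammaBarS`
  -- provides nonemptiness of `Gam`.
  have key : ∀ {Pi : Set (ControlPolicy X A)} {Gam : Set (AdversaryPolicy X A W)},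
      PiS X Q ⊆ Pi → GammaBarS X A P ⊆ Gam → Gam ⊆ GammaBarH X A P →
      (∀ (S : X × Q → ProbabilityMeasure W) (hS : Measurable S), (∀ z, S z ∈ P) → ∀ π ∈ Pi,
        ∃ hπ : π ∈ PiH X Q, AdversaryPolicy.ofReply S hS π hπ ∈ Gam) →
      u x = drscValue f hf.continuous.measurable r α x Pi Gam := by
    intro Pi Gam h1 h2 h3 h4
    refine drscValue_eq _ hα0 hα1 hr_bdd x ((GammaBarS_nonempty hP_ne).mono h2)
      (fun ε hε => ?_) fun ε hε π hπ => ?_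
    · obtain ⟨π, hπ, h⟩ := exists_mem_PiS_forall_le_policyValue hα0 hα1 hr_bdd hr hf hQ_ne hP_ne
        huc hu x hε
      exact ⟨π, h1 hπ, fun γ hγ => h γ (h3 hγ)⟩
    · obtain ⟨S, hS, hSP, h⟩ := exists_measurable_adversary_reply hα0 hr_bdd hr.continuous
        hf.continuous hP_ne hu (mul_pos hε (sub_pos.2 hα1))
      obtain ⟨hπ', hmem⟩ := h4 S hS hSP π hπ
      exact ⟨_, hmem, policyValue_ofReply_le hα0 hα1 hr_bdd hr.continuous _ hS hSP h x hπ'⟩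
  have hSH : PiS X Q ⊆ PiH X Q := PiS_subset_PiM.trans PiM_subset_PiH
  have gSH : GammaBarS X A P ⊆ GammaBarH X A P :=
    GammaBarS_subset_GammaBarM.trans GammaBarM_subset_GammaBarH
  refine ⟨key hSH gSH subset_rfl fun S hS hSP π hπ => ⟨hπ, ?_⟩,
    key PiS_subset_PiM gSH subset_rfl fun S hS hSP π hπ => ⟨hπ.1, ?_⟩,
    key PiS_subset_PiM GammaBarS_subset_GammaBarM GammaBarM_subset_GammaBarH
      fun S hS hSP π hπ => ⟨hπ.1, ?_⟩,
    key subset_rfl gSH subset_rfl fun S hS hSP π hπ => ⟨hπ.1, ?_⟩,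
    key subset_rfl GammaBarS_subset_GammaBarM GammaBarM_subset_GammaBarH
      fun S hS hSP π hπ => ⟨hπ.1, ?_⟩,
    key subset_rfl subset_rfl gSH fun S hS hSP π hπ => ⟨hπ.1, ?_⟩⟩
  · exact AdversaryPolicy.ofReply_mem_GammaBarH hSP hπ
  · exact AdversaryPolicy.ofReply_mem_GammaBarH hSP hπ.1
  · exact AdversaryPolicy.ofReply_mem_GammaBarM hSP hπ
  · exact AdversaryPolicy.ofReply_mem_GammaBarH hSP hπ.1
  · exact AdversaryPolicy.ofReply_mem_GammaBarM hSP (PiS_subset_PiM hπ)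
  · exact AdversaryPolicy.ofReply_mem_GammaBarS hSP hπ
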